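/- A hypergraph $H=(V,E)$ is weakly $m$-colorable if its vertices can be colored with $m$ colors so that no hyperedge is monochromatic; its weak chromatic number $\chi(H)$ is the smallest such $m$. A simplicial complex is PL embeddable in $\mathbb{R}^d$ if it has a simplicial subdivision that is geometrically embeddable in $\mathbb{R}^d$, i.e. whose vertices can be placed in $\mathbb{R}^d$ so that every face spans a nondegenerate simplex and any two of these simplices meet exactly in the simplex spanned by their common vertices. Let $\chi_{PL}(k,d)$ denote $\sup_H \chi(H)$, where $H$ runs over all finite $k$-uniform hypergraphs that form the collection of maximal faces of a simplicial complex which is PL embeddable in $\mathbb{R}^d$. Theorem. For every integer $d\ge 3$, $\chi_{PL}(d+1,d)=\infty$. -/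

import Mathlib

/-! Weak colorings of hypergraphs, and embeddings of simplicial complexes in Euclidean space. -/

namespace PLChromatic

/-- `H` is `k`-uniform: every hyperedge has exactly `k` elements. -/
def IsUniform {V : Type*} (H : Hypergraph V) (k : ℕ) : Prop :=
  ∀ e ∈ H.edgeSet, e.encard = k

/-- `H` is (weakly) `m`-colorable: the vertices can be colored with `m` colors such that no
hyperedge is monochromatic. -/
def WeaklyColorable {V : Type*} (H : Hypergraph V) (m : ℕ) : Prop :=
  ∃ c : H.vertexSet → Fin m, ∀ e ∈ H.edgeSet,
    ¬ ∃ i : Fin m, ∀ v : H.vertexSet, (v : V) ∈ e → c v = i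

/-- The (weak) chromatic number of `H`, the smallest `m` such that `H` is weakly `m`-colorable. -/
noncomputable def weakChromaticNumber {V : Type*} (H : Hypergraph V) : ℕ∞ :=
  ⨅ m ∈ {m : ℕ | WeaklyColorable H m}, (m : ℕ∞)

/-- `H` is the hypergraph of the maximal faces of the abstract simplicial complex `K`: its vertices
are those of `K`, and its hyperedges are the inclusion-maximal faces of `K`. -/
def IsFacetHypergraph {V : Type*} (H : Hypergraph V) (K : PreAbstractSimplicialComplex V) : Prop :=
  H.vertexSet = {v : V | {v} ∈ K.faces} ∧
  H.edgeSet = {e : Set V | ∃ s : Finset V, Maximal (· ∈ K.faces) s ∧ e = s}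

/-- The abstract simplicial complex `K` is geometrically (linearly) embeddable in `ℝ^d`: its
vertices can be placed in `ℝ^d` such that every face spans a nondegenerate simplex, and any two of
these simplices meet exactly in the simplex spanned by the common vertices. -/
def GeometricallyEmbeddable {V : Type*} (K : PreAbstractSimplicialComplex V) (d : ℕ) : Prop :=
  ∃ φ : V → EuclideanSpace ℝ (Fin d),
    (∀ s ∈ K.faces, AffineIndependent ℝ (fun v : s => φ v)) ∧
    ∀ s ∈ K.faces, ∀ t ∈ K.faces,
      convexHull ℝ (φ '' (s : Set V)) ∩ convexHull ℝ (φ '' (t : Set V)) =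
        convexHull ℝ (φ '' ((s : Set V) ∩ (t : Set V)))

/-- The geometric simplicial complex `L` is a subdivision of `K`: both have the same underlying
space, every simplex of `L` lies in a simplex of `K`, and every simplex of `K` contains only
finitely many simplices of `L`. -/
def IsSubdivision {E : Type*} [AddCommGroup E] [Module ℝ E]
    (L K : Geometry.SimplicialComplex ℝ E) : Prop :=
  L.space = K.space ∧
  (∀ s ∈ L.faces, ∃ t ∈ K.faces, convexHull ℝ (s : Set E) ⊆ convexHull ℝ (t : Set E)) ∧
  ∀ t ∈ K.faces, {s ∈ L.faces | convexHull ℝ (s : Set E) ⊆ convexHull ℝ (t : Set E)}.Finite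

open Classical in
/-- The standard geometric realization of the abstract simplicial complex `K`: a vertex `v` is
placed at the basis vector of `v` in the real vector space with basis the set of vertices. -/
noncomputable def realization {V : Type*} (K : PreAbstractSimplicialComplex V) :
    Geometry.SimplicialComplex ℝ (V →₀ ℝ) :=
  Geometry.SimplicialComplex.onFinsupp K

/-- `K` is PL embeddable in `ℝ^d`: some simplicial subdivision of `K` is, as an abstract simplicial
complex, geometrically embeddable in `ℝ^d`. -/
def PLEmbeddable {V : Type*} (K : PreAbstractSimplicialComplex V) (d : ℕ) : Prop :=
  ∃ L : Geometry.SimplicialComplex ℝ (V →₀ ℝ),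
    IsSubdivision L (realization K) ∧ GeometricallyEmbeddable L.toPreAbstractSimplicialComplex d

/-- The number `χ_PL(k, d)`: the supremum of the weak chromatic numbers of the finite `k`-uniform
hypergraphs that are the hypergraph of maximal faces of a simplicial complex which is PL embeddable
in `ℝ^d`. -/
noncomputable def chiPL (k d : ℕ) : ℕ∞ :=
  sSup {x : ℕ∞ | ∃ (V : Type) (H : Hypergraph V),
    H.vertexSet.Finite ∧ IsUniform H k ∧
    (∃ K : PreAbstractSimplicialComplex V, IsFacetHypergraph H K ∧ PLEmbeddable K d) ∧
    x = weakChromaticNumber H}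

end PLChromatic

/-! The combinatorial lines of `(Fin (d+1))^ι` have `d + 1` points each, and two distinct lines
share at most one point. By Hales–Jewett, for any number of colors some finite `ι` forces a
monochromatic line. It therefore suffices that every finite family of `(d+1)`-sets meeting pairwise
in at most one vertex spans a complex PL embeddable in `ℝ^d` (`plEmbeddable_complexOf`).

Place the vertices generically. Each facet `F` becomes a nondegenerate simplex with centroid `c_F`.
Since `d ≥ 3`, the segments from `c_F` and `c_G` to vertices of `F` and `G` meet, for `F ≠ G`, only
at a common vertex. The simplices themselves may overlap, so each is made spiky: on the barycentric
subdivision the vertices stay fixed, and every other barycenter is contracted towards `c_F` by a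
small factor `ε`. The image of `F` then lies near the star of segments from `c_F`, and different
facets meet only at shared vertices. The contractions are compatible because a face with two
vertices lies in only one facet.

Injectivity of the resulting piecewise linear map is phrased as `UniqueWeights`. Within one facet it
follows from uniqueness of chain decompositions (`IsChainWeight.ext`), and between facets from
`GeneralPosition.exists_separating`. -/

namespace PLChromatic

open Finset

/-! ### Convex weights and injectivity of simplexwise linear maps -/

section Weights

variable {A E : Type*} [Fintype A] [AddCommGroup E] [Module ℝ E]

/-- `μ` is a system of convex weights supported on `s`. -/
structure IsWeight (s : Finset A) (μ : A → ℝ) : Prop where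
  nonneg : ∀ a, 0 ≤ μ a
  eq_zero : ∀ a, a ∉ s → μ a = 0
  sum_eq : ∑ a, μ a = 1

theorem mem_convexHull_image_iff {s : Finset A} {ψ : A → E} {x : E} :
    x ∈ convexHull ℝ (ψ '' (s : Set A)) ↔ ∃ μ, IsWeight s μ ∧ ∑ a, μ a • ψ a = x := by
  classical
  constructor
  · intro hx
    let C : Set E := {x | ∃ μ, IsWeight s μ ∧ ∑ a, μ a • ψ a = x}
    have hC : Convex ℝ C := by
      rintro _ ⟨μ, hμ, rfl⟩ _ ⟨ν, hν, rfl⟩ a b ha hb hab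
      refine ⟨fun i => a * μ i + b * ν i, ⟨fun i => ?_, fun i hi => ?_, ?_⟩, ?_⟩
      · have := hμ.nonneg i
        have := hν.nonneg i
        positivity
      · simp [hμ.eq_zero i hi, hν.eq_zero i hi]
      · rw [sum_add_distrib, ← mul_sum, ← mul_sum, hμ.sum_eq, hν.sum_eq, mul_one, mul_one, hab]
      · simp [add_smul, sum_add_distrib, mul_smul, smul_sum]
    refine convexHull_min ?_ hC hx
    rintro _ ⟨a, ha, rfl⟩
    refine ⟨Pi.single a 1, ⟨fun i => ?_, fun i hi => ?_, by simp⟩, ?_⟩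
    · by_cases h : i = a
      · subst h; simp
      · simp [h]
    · exact Pi.single_eq_of_ne (fun h => hi (by simpa [h] using ha)) _
    · simp [Pi.single_apply, ite_smul]
  · rintro ⟨μ, hμ, rfl⟩
    rw [← sum_subset (subset_univ s) (fun a _ ha => by rw [hμ.eq_zero a ha, zero_smul])]
    refine (convex_convexHull ℝ _).sum_mem (fun a _ => hμ.nonneg a) ?_
      fun a ha => subset_convexHull ℝ _ ⟨a, ha, rfl⟩
    rw [sum_subset (subset_univ s) (fun a _ ha => hμ.eq_zero a ha), hμ.sum_eq]

/-- Convex combinations of the points `ψ a` with weights supported on members of `S` have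
uniquely determined weights. -/
def UniqueWeights (S : Set (Finset A)) (ψ : A → E) : Prop :=
  ∀ s ∈ S, ∀ t ∈ S, ∀ μ ν, IsWeight s μ → IsWeight t ν →
    ∑ a, μ a • ψ a = ∑ a, ν a • ψ a → μ = ν

/-- The positive and negative parts of an affine dependency have equal mass. Normalized, they are
two systems of weights for the same point, so they agree and the dependency is zero. -/
theorem UniqueWeights.affineIndependent {S : Set (Finset A)} {ψ : A → E}
    (h : UniqueWeights S ψ) {s : Finset A} (hs : s ∈ S) :
    AffineIndependent ℝ (fun a : s => ψ a) := by
  classical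
  have key : ∀ w : A → ℝ, (∀ a, a ∉ s → w a = 0) → ∑ a, w a = 0 → ∑ a, w a • ψ a = 0 →
      w = 0 := by
    intro w hws hw0 hw
    let P := ∑ a, max (w a) 0
    have hN : ∑ a, max (-w a) 0 = P := by
      have hdiff : P - ∑ a, max (-w a) 0 = ∑ a, w a := by
        rw [← sum_sub_distrib]
        refine sum_congr rfl fun a _ => ?_
        rcases le_total (w a) 0 with h | h <;> simp [h]
      linarith
    have hP : 0 ≤ P := sum_nonneg fun a _ => le_max_right _ _
    rcases hP.eq_or_lt with hP0 | hP0
    · have h1 := (sum_eq_zero_iff_of_nonneg fun a _ => le_max_right (w a) 0).1 hP0.symm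
      have h2 := (sum_eq_zero_iff_of_nonneg fun a _ => le_max_right (-w a) 0).1 (hN.trans hP0.symm)
      funext a
      have h1a := h1 a (mem_univ a)
      have h2a := h2 a (mem_univ a)
      have := le_max_left (w a) 0
      have := le_max_left (-w a) 0
      simp only [Pi.zero_apply]
      linarith
    · have heq := h s hs s hs (fun a => max (w a) 0 / P) (fun a => max (-w a) 0 / P)
        ⟨fun a => div_nonneg (le_max_right _ _) hP, fun a ha => by simp [hws a ha],
          by rw [← sum_div]; exact div_self hP0.ne'⟩
        ⟨fun a => div_nonneg (le_max_right _ _) hP, fun a ha => by simp [hws a ha],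
          by rw [← sum_div, hN]; exact div_self hP0.ne'⟩ (by
          rw [← sub_eq_zero, ← sum_sub_distrib]
          have : ∀ a, (max (w a) 0 / P) • ψ a - (max (-w a) 0 / P) • ψ a
              = P⁻¹ • (w a • ψ a) := by
            intro a
            rw [← sub_smul, smul_smul]
            congr 1
            rcases le_total (w a) 0 with h | h <;> simp [h] <;> ring
          simp_rw [this, ← smul_sum, hw, smul_zero])
      funext a
      have ha := congrFun heq a
      rw [div_left_inj' hP0.ne'] at ha
      rcases le_total (w a) 0 with h | h <;> simp [h] at ha <;> simp [ha]
  rw [affineIndependent_iff]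
  intro r w hw0 hw e he
  let w' : A → ℝ := fun a => if ha : a ∈ s then if (⟨a, ha⟩ : s) ∈ r then w ⟨a, ha⟩ else 0 else 0
  have hw'1 : ∑ a, w' a = ∑ e ∈ r, w e := by
    rw [← sum_subset (subset_univ s) (fun a _ ha => by simp [w', ha]), ← sum_coe_sort s,
      ← sum_subset (subset_univ r) (fun a _ ha => by simp [w', ha])]
    exact sum_congr rfl fun a ha => by simp [w', ha]
  have hw'2 : ∑ a, w' a • ψ a = ∑ e ∈ r, w e • ψ e := by
    rw [← sum_subset (subset_univ s) (fun a _ ha => by simp [w', ha]), ← sum_coe_sort s,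
      ← sum_subset (subset_univ r) (fun a _ ha => by simp [w', ha])]
    exact sum_congr rfl fun a ha => by simp [w', ha]
  have h0 := key w' (fun a ha => by simp [w', ha]) (hw'1.trans hw0) (hw'2.trans hw)
  simpa [w', he] using congrFun h0 e

theorem UniqueWeights.convexHull_inter [DecidableEq A] {S : Set (Finset A)} {ψ : A → E}
    (h : UniqueWeights S ψ) {s t : Finset A} (hs : s ∈ S) (ht : t ∈ S) :
    convexHull ℝ (ψ '' (s : Set A)) ∩ convexHull ℝ (ψ '' (t : Set A)) =
      convexHull ℝ (ψ '' ((s : Set A) ∩ (t : Set A))) := by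
  refine Set.Subset.antisymm ?_ (Set.subset_inter
    (convexHull_mono (Set.image_mono Set.inter_subset_left))
    (convexHull_mono (Set.image_mono Set.inter_subset_right)))
  rintro x ⟨hxs, hxt⟩
  obtain ⟨μ, hμ, rfl⟩ := mem_convexHull_image_iff.1 hxs
  obtain ⟨ν, hν, hμν⟩ := mem_convexHull_image_iff.1 hxt
  obtain rfl := h s hs t ht μ ν hμ hν hμν.symm
  rw [← coe_inter, mem_convexHull_image_iff]
  refine ⟨μ, ⟨hμ.nonneg, fun a ha => ?_, hμ.sum_eq⟩, rfl⟩
  by_contra h0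
  exact ha (mem_inter.2 ⟨by_contra fun h' => h0 (hμ.eq_zero a h'),
    by_contra fun h' => h0 (hν.eq_zero a h')⟩)

end Weights

/-! ### Layer decompositions along chains of sets -/

section Chains

variable {V : Type*} [Fintype V] [DecidableEq V]

/-- `μ` is a nonnegative function supported on a chain of nonempty finite sets. -/
structure IsChainWeight (μ : Finset V → ℝ) : Prop where
  nonneg : ∀ σ, 0 ≤ μ σ
  empty : μ ∅ = 0
  chain : ∀ σ τ, μ σ ≠ 0 → μ τ ≠ 0 → σ ⊆ τ ∨ τ ⊆ σ

/-- The largest set of the chain contains all the others, so it can be read off from the vertex sums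
alone. -/
theorem IsChainWeight.exists_support {μ : Finset V → ℝ} (h : IsChainWeight μ) (h0 : μ ≠ 0) :
    ∃ τ, μ τ ≠ 0 ∧ ∀ v, v ∈ τ ↔ ∑ σ with v ∈ σ, μ σ ≠ 0 := by
  obtain ⟨σ₀, hσ₀⟩ := Function.ne_iff.1 h0
  obtain ⟨τ, hτ⟩ := (univ.filter fun σ => μ σ ≠ 0).exists_maximal ⟨σ₀, by simpa using hσ₀⟩
  have hτ0 : μ τ ≠ 0 := by simpa using hτ.prop
  refine ⟨τ, hτ0, fun v => ?_⟩
  rw [Ne, sum_eq_zero_iff_of_nonneg fun σ _ => h.nonneg σ]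
  constructor
  · exact fun hv h' => hτ0 (h' τ (by simpa using hv))
  · intro hv
    push Not at hv
    obtain ⟨σ, hσ, hσ0⟩ := hv
    have hvσ : v ∈ σ := by simpa using hσ
    rcases h.chain σ τ hσ0 hτ0 with h1 | h1
    · exact h1 hvσ
    · exact hτ.le_of_ge (by simpa using hσ0) h1 hvσ

/-- The decomposition of a function as a nonnegative combination of indicator functions of a
chain of nonempty sets is unique. -/
theorem IsChainWeight.ext {μ ν : Finset V → ℝ} (hμ : IsChainWeight μ) (hν : IsChainWeight ν)
    (h : ∀ v, ∑ σ with v ∈ σ, μ σ = ∑ σ with v ∈ σ, ν σ) : μ = ν := by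
  have aux : ∀ {μ ν : Finset V → ℝ}, IsChainWeight μ → IsChainWeight ν →
      IsChainWeight fun σ => μ σ - min (μ σ) (ν σ) := by
    intro μ ν hμ hν
    have hne : ∀ σ, μ σ - min (μ σ) (ν σ) ≠ 0 → μ σ ≠ 0 := by
      intro σ h h0
      rw [h0, min_eq_left (hν.nonneg σ)] at h
      simp at h
    exact ⟨fun σ => sub_nonneg.2 (min_le_left _ _), by simp [hμ.empty, hν.empty],
      fun σ τ hσ hτ => hμ.chain σ τ (hne σ hσ) (hne τ hτ)⟩
  -- Cancel the common part `min μ ν`: the remainders have equal vertex sums and no set in common.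
  -- If both were nonzero, their largest sets would coincide, each being the support of those sums.
  have h1 := aux hμ hν
  have h2 := aux hν hμ
  set μ' : Finset V → ℝ := fun σ => μ σ - min (μ σ) (ν σ) with hμ'
  set ν' : Finset V → ℝ := fun σ => ν σ - min (ν σ) (μ σ) with hν'
  have hsum : ∀ v, ∑ σ with v ∈ σ, μ' σ = ∑ σ with v ∈ σ, ν' σ := by
    intro v
    simp only [hμ', hν', sum_sub_distrib, h v, min_comm]
  have hzero : ∀ {μ ν : Finset V → ℝ}, IsChainWeight μ → ν = 0 →
      (∀ v, ∑ σ with v ∈ σ, μ σ = ∑ σ with v ∈ σ, ν σ) → μ = 0 := by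
    rintro μ _ hμ rfl hs
    by_contra h0
    obtain ⟨τ, hτ, hv⟩ := hμ.exists_support h0
    have hne : τ ≠ ∅ := by rintro rfl; exact hτ hμ.empty
    obtain ⟨v, hvτ⟩ := nonempty_iff_ne_empty.2 hne
    exact (hv v).1 hvτ (by simp [hs])
  have hfin : μ' = 0 ∧ ν' = 0 := by
    by_cases hm : μ' = 0
    · exact ⟨hm, hzero h2 hm fun v => (hsum v).symm⟩
    by_cases hn : ν' = 0
    · exact absurd (hzero h1 hn hsum) hm
    exfalso
    obtain ⟨τ, hτ, hv⟩ := h1.exists_support hm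
    obtain ⟨τ', hτ', hv'⟩ := h2.exists_support hn
    have : τ = τ' := by
      ext v
      rw [hv, hv', hsum]
    subst this
    rcases le_total (μ τ) (ν τ) with h | h
    · exact hτ (by simp [hμ', h])
    · exact hτ' (by simp [hν', h])
  funext σ
  have e1 := congrFun hfin.1 σ
  have e2 := congrFun hfin.2 σ
  simp only [hμ', hν', Pi.zero_apply, min_comm (ν σ)] at e1 e2
  linarith

/-- Every nonnegative function is a nonnegative combination of the indicator functions of a chain
of nonempty sets. -/
theorem exists_isChainWeight (g : V → ℝ) (hg : ∀ v, 0 ≤ g v) :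
    ∃ μ, IsChainWeight μ ∧ (∀ v, ∑ σ with v ∈ σ, μ σ = g v) ∧
      ∀ σ, μ σ ≠ 0 → ∀ v ∈ σ, g v ≠ 0 := by
  induction hn : (univ.filter fun v => g v ≠ 0).card using Nat.strong_induction_on generalizing g
    with
  | _ n ih =>
  set U := univ.filter fun v => g v ≠ 0 with hU
  have memU : ∀ v, v ∈ U ↔ g v ≠ 0 := fun v => by simp [hU]
  rcases U.eq_empty_or_nonempty with hU0 | hU0
  · refine ⟨0, ⟨by simp, rfl, by simp⟩, fun v => ?_, by simp⟩
    have : v ∉ U := by simp [hU0]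
    rw [memU, not_not] at this
    simp [this]
  obtain ⟨v₀, hv₀, hmin⟩ := U.exists_min_image g hU0
  -- Peel off a layer: subtracting the least positive value `m` on the support `U` shrinks the
  -- support, and `U` contains every set used afterwards.
  set m := g v₀ with hm
  have hm0 : 0 < m := lt_of_le_of_ne (hg v₀) (Ne.symm ((memU v₀).1 hv₀))
  let g' : V → ℝ := fun v => if v ∈ U then g v - m else 0
  have hg' : ∀ v, 0 ≤ g' v := by
    intro v
    by_cases h : v ∈ U
    · simpa [g', h] using hmin v h
    · simp [g', h]
  have hg'U : ∀ v, g' v ≠ 0 → v ∈ U := by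
    intro v hv
    by_contra h
    exact hv (by simp [g', h])
  have hlt : (univ.filter fun v => g' v ≠ 0).card < n := by
    rw [← hn]
    refine card_lt_card ⟨fun v hv => hg'U v (by simpa using hv), fun h => ?_⟩
    have := h hv₀
    simp [g', hv₀, hm] at this
  obtain ⟨μ, hμ, hs, hsupp⟩ := ih _ hlt g' hg' rfl
  have hμU : μ U = 0 := by
    by_contra h
    exact hsupp U h v₀ hv₀ (by simp [g', hv₀, hm])
  have hsub : ∀ σ, μ σ ≠ 0 → σ ⊆ U := fun σ hσ v hv => hg'U v (hsupp σ hσ v hv)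
  have hcase : ∀ σ, μ σ + (if σ = U then m else 0) ≠ 0 → σ = U ∨ μ σ ≠ 0 := by
    intro σ h
    by_cases h' : σ = U
    · exact Or.inl h'
    · right; simpa [h'] using h
  refine ⟨fun σ => μ σ + if σ = U then m else 0, ⟨fun σ => ?_, ?_, ?_⟩, fun v => ?_, ?_⟩
  · have := hμ.nonneg σ
    split_ifs <;> positivity
  · simp [hμ.empty, hU0.ne_empty.symm]
  · intro σ τ hσ hτ
    rcases hcase σ hσ with rfl | hσ'
    · rcases hcase τ hτ with rfl | hτ'
      · exact Or.inl le_rfl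
      · exact Or.inr (hsub τ hτ')
    · rcases hcase τ hτ with rfl | hτ'
      · exact Or.inl (hsub σ hσ')
      · exact hμ.chain σ τ hσ' hτ'
  · rw [sum_add_distrib, hs, sum_ite_eq']
    by_cases h : v ∈ U
    · simp [g', h]
    · have h0 : g v = 0 := by simpa [memU] using h
      simp [g', h, h0]
  · intro σ hσ v hv
    rcases hcase σ hσ with rfl | hσ'
    · exact (memU v).1 hv
    · exact (memU v).1 (hsub σ hσ' hv)

end Chains

end PLChromatic

namespace PLChromatic

open Finset

/-! ### Properties holding off the zero set of a polynomial -/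

section Generic

variable {τ : Type*}

/-- The property `P` holds outside the zero set of some nonzero polynomial. -/
def Generic (P : (τ → ℝ) → Prop) : Prop :=
  ∃ Q : MvPolynomial τ ℝ, Q ≠ 0 ∧ ∀ x, MvPolynomial.eval x Q ≠ 0 → P x

theorem Generic.exists {P : (τ → ℝ) → Prop} (h : Generic P) : ∃ x, P x := by
  obtain ⟨Q, hQ, hP⟩ := h
  by_contra! hx
  exact hQ (MvPolynomial.funext fun x => by
    rw [map_zero]
    by_contra h0
    exact hx x (hP x h0))

theorem Generic.mono {P P' : (τ → ℝ) → Prop} (h : Generic P) (hP : ∀ x, P x → P' x) :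
    Generic P' :=
  let ⟨Q, hQ, hx⟩ := h
  ⟨Q, hQ, fun x h0 => hP x (hx x h0)⟩

theorem Generic.of_imp {c : Prop} {P : (τ → ℝ) → Prop} (h : c → Generic P) :
    Generic fun x => c → P x := by
  by_cases hc : c
  · exact (h hc).mono fun x hx _ => hx
  · exact ⟨1, one_ne_zero, fun x _ h' => absurd h' hc⟩

theorem Generic.forall {ι : Type*} [Finite ι] {P : ι → (τ → ℝ) → Prop}
    (h : ∀ i, Generic (P i)) : Generic fun x => ∀ i, P i x := by
  have := Fintype.ofFinite ι
  choose Q hQ hP using h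
  refine ⟨∏ i, Q i, prod_ne_zero_iff.2 fun i _ => hQ i, fun x hx i => hP i x ?_⟩
  rw [map_prod] at hx
  exact prod_ne_zero_iff.1 hx i (mem_univ i)

theorem Generic.and {P P' : (τ → ℝ) → Prop} (h : Generic P) (h' : Generic P') :
    Generic fun x => P x ∧ P' x := by
  have : Generic fun x => ∀ b : Bool, (bif b then P x else P' x) :=
    Generic.forall fun b => by cases b <;> assumption
  exact this.mono fun x hx => ⟨hx true, hx false⟩

/-- The determinant is a polynomial in the coordinates, so a single configuration where it is
nonzero proves genericity. -/
theorem Generic.det_ne_zero {n : Type*} [Fintype n] [DecidableEq n]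
    (M : Matrix n n (MvPolynomial τ ℝ)) (x₀ : τ → ℝ)
    (h : (M.map (MvPolynomial.eval x₀)).det ≠ 0) :
    Generic fun x => (M.map (MvPolynomial.eval x)).det ≠ 0 := by
  have key : ∀ x, (M.map (MvPolynomial.eval x)).det = MvPolynomial.eval x M.det := fun x =>
    (RingHom.map_det _ _).symm
  refine ⟨M.det, fun h0 => h ?_, fun x hx => by simpa only [key] using hx⟩
  rw [key, h0, map_zero]

end Generic

/-- The centroid of the points `p v` with `v ∈ σ`. -/
noncomputable def centroid {V E : Type*} [AddCommGroup E] [Module ℝ E] (p : V → E)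
    (σ : Finset V) : E :=
  (σ.card : ℝ)⁻¹ • ∑ v ∈ σ, p v

/-! ### Generic placement of the vertices -/

section Configuration

variable {V : Type*} {d : ℕ}

/-- The points of a Euclidean space with given coordinates. -/
noncomputable def pointOf (x : V × Fin d → ℝ) (v : V) : EuclideanSpace ℝ (Fin d) :=
  WithLp.toLp 2 fun i => x (v, i)

theorem pointOf_apply (x : V × Fin d → ℝ) (v : V) (i : Fin d) : pointOf x v i = x (v, i) := rfl

theorem centroid_pointOf_apply (x : V × Fin d → ℝ) (F : Finset V) (i : Fin d) :
    centroid (pointOf x) F i = (F.card : ℝ)⁻¹ * ∑ u ∈ F, x (u, i) := by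
  simp [centroid, pointOf_apply]

/-- The coordinates of a centroid as polynomials. -/
noncomputable def centroidPoly (F : Finset V) (i : Fin d) : MvPolynomial (V × Fin d) ℝ :=
  MvPolynomial.C (F.card : ℝ)⁻¹ * ∑ u ∈ F, MvPolynomial.X (u, i)

theorem eval_centroidPoly (x : V × Fin d → ℝ) (F : Finset V) (i : Fin d) :
    MvPolynomial.eval x (centroidPoly F i) = (F.card : ℝ)⁻¹ * ∑ u ∈ F, x (u, i) := by
  simp [centroidPoly]

theorem generic_affineIndependent [Finite V] (F : Finset V) (hF : F.card = d + 1) :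
    Generic fun x : V × Fin d → ℝ => ∀ w : V → ℝ, ∑ v ∈ F, w v = 0 →
      ∑ v ∈ F, w v • pointOf x v = 0 → ∀ v ∈ F, w v = 0 := by
  have := Fintype.ofFinite V
  let e : Fin (d + 1) ≃ F := (F.equivFinOfCardEq hF).symm
  let M : Matrix (Fin (d + 1)) (Fin (d + 1)) (MvPolynomial (V × Fin d) ℝ) :=
    Matrix.of fun i j => Fin.cases 1 (fun k => MvPolynomial.X ((e i : V), k)) j
  let g : V → ℝ := fun v => (Fintype.equivFin V v : ℕ)
  have hg : Function.Injective g := fun v w h => by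
    simpa [g, Fin.val_inj] using h
  -- The witness puts the vertices at distinct parameters of the moment curve, turning `M` into a
  -- Vandermonde matrix.
  refine (Generic.det_ne_zero M (fun q => g q.1 ^ ((q.2 : ℕ) + 1)) ?_).mono ?_
  · have : M.map (MvPolynomial.eval fun q => g q.1 ^ ((q.2 : ℕ) + 1)) =
        Matrix.vandermonde fun i => g (e i) := by
      ext i j
      refine Fin.cases ?_ (fun k => ?_) j <;> simp [M, Matrix.vandermonde_apply]
    rw [this, Matrix.det_vandermonde_ne_zero_iff]
    exact fun i j h => e.injective (Subtype.ext (hg h))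
  · intro x hx w hw0 hw
    have hsum : ∀ f : V → ℝ, ∑ i, f (e i) = ∑ v ∈ F, f v := fun f => by
      rw [e.sum_comp fun v => f v, sum_coe_sort F f]
    have hz := Matrix.eq_zero_of_vecMul_eq_zero hx (v := fun i => w (e i)) (by
      funext j
      simp only [Matrix.vecMul, dotProduct, Matrix.map_apply, Pi.zero_apply]
      refine Fin.cases ?_ (fun k => ?_) j
      · simp only [M, Matrix.of_apply, Fin.cases_zero, map_one, mul_one]
        rw [hsum w, hw0]
      · simp only [M, Matrix.of_apply, Fin.cases_succ, MvPolynomial.eval_X]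
        rw [hsum fun v => w v * x (v, k)]
        have := congrArg (fun y : EuclideanSpace ℝ (Fin d) => y k) hw
        simpa [pointOf_apply] using this)
    intro v hv
    simpa using congrFun hz (e.symm ⟨v, hv⟩)

variable [DecidableEq V]

theorem exists_mem_sdiff {F G : Finset V} (hF : 4 ≤ F.card) (hFG : (F ∩ G).card ≤ 1) (v : V) :
    ∃ a ∈ F, a ∉ G ∧ a ≠ v := by
  have h1 : 2 ≤ (F \ G).card := by
    have := card_sdiff_add_card_inter F G
    omega
  obtain ⟨a, ha, hav⟩ := exists_mem_ne h1 v
  exact ⟨a, (mem_sdiff.1 ha).1, (mem_sdiff.1 ha).2, hav⟩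

/-- A common point gives `(w - v) - s (c_F - v) + t (c_G - w) = 0`, a nontrivial relation between
three vectors. Generically these are independent, already in three coordinates; this is where `d ≥
3` is needed. -/
theorem generic_disjoint_segment (hd : 3 ≤ d) {F G : Finset V} (hF : 4 ≤ F.card)
    (hG : 4 ≤ G.card) (hFG : (F ∩ G).card ≤ 1) {v w : V} (hv : v ∈ F) (hw : w ∈ G)
    (hvw : v ≠ w) :
    Generic fun x : V × Fin d → ℝ =>
      Disjoint (segment ℝ (pointOf x v) (centroid (pointOf x) F))
        (segment ℝ (pointOf x w) (centroid (pointOf x) G)) := by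
  obtain ⟨a, haF, haG, hav⟩ := exists_mem_sdiff hF hFG v
  obtain ⟨b, hbG, hbF, hbw⟩ := exists_mem_sdiff hG (by rwa [inter_comm]) w
  have haw : a ≠ w := by rintro rfl; exact haG hw
  have hbv : b ≠ v := by rintro rfl; exact hbF hv
  have hab : a ≠ b := by rintro rfl; exact haG hbG
  have hF0 : (F.card : ℝ) ≠ 0 := by positivity
  have hG0 : (G.card : ℝ) ≠ 0 := by positivity
  let k : Fin 3 → Fin d := Fin.castLE hd
  let M : Matrix (Fin 3) (Fin 3) (MvPolynomial (V × Fin d) ℝ) :=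
    Matrix.of ![fun i => MvPolynomial.X (w, k i) - MvPolynomial.X (v, k i),
      fun i => centroidPoly F (k i) - MvPolynomial.X (v, k i),
      fun i => centroidPoly G (k i) - MvPolynomial.X (w, k i)]
  -- `w`, `a`, `b` go to three basis vectors and all other vertices to the origin. As `a` lies only
  -- in `F` and `b` only in `G`, the matrix is triangular.
  let x₀ : V × Fin d → ℝ := fun q =>
    (if q.1 = w then (if q.2 = k 0 then 1 else 0) else 0) +
    (if q.1 = a then (if q.2 = k 1 then 1 else 0) else 0) +
    (if q.1 = b then (if q.2 = k 2 then 1 else 0) else 0)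
  have k01 : k 0 ≠ k 1 := by simp [k, Fin.ext_iff]
  have k02 : k 0 ≠ k 2 := by simp [k, Fin.ext_iff]
  have k12 : k 1 ≠ k 2 := by simp [k, Fin.ext_iff]
  refine (Generic.det_ne_zero M x₀ ?_).mono ?_
  · have : (M.map (MvPolynomial.eval x₀)).det = (F.card : ℝ)⁻¹ * (G.card : ℝ)⁻¹ := by
      rw [Matrix.det_fin_three]
      simp [M, eval_centroidPoly, x₀, k01, k02, k12, k01.symm, k02.symm,
        k12.symm, hvw, hav.symm, haw.symm, hbw.symm, hbv.symm, haF, haG, hbF, hbG, hw]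
    rw [this]
    positivity
  · intro x hx
    rw [Set.disjoint_left]
    intro y hy hy'
    rw [segment_eq_image] at hy hy'
    obtain ⟨s, -, rfl⟩ := hy
    obtain ⟨t, -, hst⟩ := hy'
    have hz := Matrix.eq_zero_of_vecMul_eq_zero hx (v := ![1, -s, t]) (by
      funext i
      have := congrArg (fun y : EuclideanSpace ℝ (Fin d) => y (k i)) hst
      simp only [PiLp.add_apply, PiLp.smul_apply, smul_eq_mul, centroid_pointOf_apply,
        pointOf_apply] at this
      simp only [Matrix.vecMul, dotProduct, Fin.sum_univ_three, Matrix.map_apply, M,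
        Matrix.of_apply, Matrix.cons_val, map_sub, MvPolynomial.eval_X, eval_centroidPoly,
        Pi.zero_apply]
      linear_combination this)
    simpa using congrFun hz 0

/-- Membership would make `c_F - v` a multiple of `c_G - v`; vertices private to `F` and to `G` make
these generically independent. -/
theorem generic_centroid_notMem_segment (hd : 3 ≤ d) {F G : Finset V} (hF : 4 ≤ F.card)
    (hG : 4 ≤ G.card) (hFG : (F ∩ G).card ≤ 1) (v : V) :
    Generic fun x : V × Fin d → ℝ =>
      centroid (pointOf x) F ∉ segment ℝ (pointOf x v) (centroid (pointOf x) G) := by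
  obtain ⟨a, haF, haG, hav⟩ := exists_mem_sdiff hF hFG v
  obtain ⟨b, hbG, hbF, hbv⟩ := exists_mem_sdiff hG (by rwa [inter_comm]) v
  have hF0 : (F.card : ℝ) ≠ 0 := by positivity
  have hG0 : (G.card : ℝ) ≠ 0 := by positivity
  let k : Fin 2 → Fin d := Fin.castLE (by omega)
  let M : Matrix (Fin 2) (Fin 2) (MvPolynomial (V × Fin d) ℝ) :=
    Matrix.of ![fun i => centroidPoly F (k i) - MvPolynomial.X (v, k i),
      fun i => centroidPoly G (k i) - MvPolynomial.X (v, k i)]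
  let x₀ : V × Fin d → ℝ := fun q =>
    (if q.1 = a then (if q.2 = k 0 then 1 else 0) else 0) +
    (if q.1 = b then (if q.2 = k 1 then 1 else 0) else 0)
  have k01 : k 0 ≠ k 1 := by simp [k, Fin.ext_iff]
  refine (Generic.det_ne_zero M x₀ ?_).mono ?_
  · have : (M.map (MvPolynomial.eval x₀)).det = (F.card : ℝ)⁻¹ * (G.card : ℝ)⁻¹ := by
      rw [Matrix.det_fin_two]
      simp [M, eval_centroidPoly, x₀, k01, k01.symm,
        hav.symm, hbv.symm, haF, haG, hbF, hbG]
    rw [this]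
    positivity
  · intro x hx hy
    rw [segment_eq_image] at hy
    obtain ⟨t, -, hst⟩ := hy
    have hz := Matrix.eq_zero_of_vecMul_eq_zero hx (v := ![1, -t]) (by
      funext i
      have := congrArg (fun y : EuclideanSpace ℝ (Fin d) => y (k i)) hst
      simp only [PiLp.add_apply, PiLp.smul_apply, smul_eq_mul, centroid_pointOf_apply,
        pointOf_apply] at this
      simp only [Matrix.vecMul, dotProduct, Fin.sum_univ_two, Matrix.map_apply, M,
        Matrix.of_apply, Matrix.cons_val, map_sub, MvPolynomial.eval_X, eval_centroidPoly,
        Pi.zero_apply]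
      linear_combination -this)
    simpa using congrFun hz 0

/-- The points `p v` are in general position with respect to the facets in `𝓕`, in the sense that
facets span nondegenerate simplices and the segments from their centroids to their vertices meet
only at common vertices. -/
structure GeneralPosition {E : Type*} [AddCommGroup E] [Module ℝ E] (𝓕 : Set (Finset V))
    (p : V → E) : Prop where
  indep : ∀ F ∈ 𝓕, ∀ w : V → ℝ, ∑ v ∈ F, w v = 0 → ∑ v ∈ F, w v • p v = 0 → ∀ v ∈ F, w v = 0
  disjoint : ∀ F ∈ 𝓕, ∀ G ∈ 𝓕, F ≠ G → ∀ v ∈ F, ∀ w ∈ G, v ≠ w →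
    Disjoint (segment ℝ (p v) (centroid p F)) (segment ℝ (p w) (centroid p G))
  notMem : ∀ F ∈ 𝓕, ∀ G ∈ 𝓕, F ≠ G → ∀ v, centroid p F ∉ segment ℝ (p v) (centroid p G)

theorem exists_generalPosition [Finite V] (hd : 3 ≤ d) {𝓕 : Set (Finset V)}
    (hcard : ∀ F ∈ 𝓕, F.card = d + 1)
    (hlin : ∀ F ∈ 𝓕, ∀ G ∈ 𝓕, F ≠ G → (F ∩ G).card ≤ 1) :
    ∃ p : V → EuclideanSpace ℝ (Fin d), GeneralPosition 𝓕 p := by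
  have h1 : Generic fun x : V × Fin d → ℝ => ∀ F, F ∈ 𝓕 → ∀ w : V → ℝ, ∑ v ∈ F, w v = 0 →
      ∑ v ∈ F, w v • pointOf x v = 0 → ∀ v ∈ F, w v = 0 :=
    Generic.forall fun F => Generic.of_imp fun hF => generic_affineIndependent F (hcard F hF)
  have hcard' : ∀ F ∈ 𝓕, 4 ≤ F.card := fun F hF => by have := hcard F hF; omega
  have h2 : Generic fun x : V × Fin d → ℝ => ∀ F, F ∈ 𝓕 → ∀ G, G ∈ 𝓕 → F ≠ G →
      ∀ v, v ∈ F → ∀ w, w ∈ G → v ≠ w →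
      Disjoint (segment ℝ (pointOf x v) (centroid (pointOf x) F))
        (segment ℝ (pointOf x w) (centroid (pointOf x) G)) :=
    Generic.forall fun F => Generic.of_imp fun hF => Generic.forall fun G =>
      Generic.of_imp fun hG => Generic.of_imp fun hFG => Generic.forall fun v =>
      Generic.of_imp fun hv => Generic.forall fun w => Generic.of_imp fun hw =>
      Generic.of_imp fun hvw => generic_disjoint_segment hd (hcard' F hF) (hcard' G hG)
        (hlin F hF G hG hFG) hv hw hvw
  have h3 : Generic fun x : V × Fin d → ℝ => ∀ F, F ∈ 𝓕 → ∀ G, G ∈ 𝓕 → F ≠ G → ∀ v,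
      centroid (pointOf x) F ∉ segment ℝ (pointOf x v) (centroid (pointOf x) G) :=
    Generic.forall fun F => Generic.of_imp fun hF => Generic.forall fun G =>
      Generic.of_imp fun hG => Generic.of_imp fun hFG => Generic.forall fun v =>
      generic_centroid_notMem_segment hd (hcard' F hF) (hcard' G hG) (hlin F hF G hG hFG) v
  obtain ⟨x, hx1, hx2, hx3⟩ := (h1.and (h2.and h3)).exists
  exact ⟨pointOf x, hx1, hx2, hx3⟩

end Configuration

/-! ### Uniform separation of thin spikes -/

section Separation

open Filter Topology

variable {E : Type*} [NormedAddCommGroup E] [NormedSpace ℝ E]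

theorem mem_thickening_segment {p c y : E} {δ t : ℝ} (ht : t ∈ Set.Icc (0 : ℝ) 1)
    (hy : dist y c < δ) : (1 - t) • p + t • y ∈ Metric.thickening δ (segment ℝ p c) := by
  rw [Metric.mem_thickening_iff]
  refine ⟨(1 - t) • p + t • c, ⟨1 - t, t, by linarith [ht.2], ht.1, by ring, rfl⟩, ?_⟩
  rw [dist_add_left, dist_smul₀, Real.norm_of_nonneg ht.1]
  calc t * dist y c ≤ 1 * dist y c := by gcongr; exact ht.2
    _ < δ := by simpa using hy

theorem isCompact_segment (p c : E) : IsCompact (segment ℝ p c) := by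
  rw [segment_eq_image]
  exact isCompact_Icc.image (by fun_prop)

theorem exists_separating_of_disjoint {p q c c' : E}
    (h : Disjoint (segment ℝ p c) (segment ℝ q c')) :
    ∃ δ > 0, ∀ y y', dist y c < δ → dist y' c' < δ → ∀ t ∈ Set.Icc (0 : ℝ) 1,
      ∀ s ∈ Set.Icc (0 : ℝ) 1, (1 - t) • p + t • y ≠ (1 - s) • q + s • y' := by
  obtain ⟨δ, hδ, hdis⟩ := h.exists_thickenings (isCompact_segment p c)
    (isCompact_segment q c').isClosed
  refine ⟨δ, hδ, fun y y' hy hy' t ht s hs heq => Set.disjoint_left.1 hdis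
    (mem_thickening_segment ht hy) ?_⟩
  rw [heq]
  exact mem_thickening_segment hs hy'

/-- If `t > 0` and `s ≤ t`, solving for `y` puts it on the segment from `p` to `y'`, hence near `[p,
c']`, although it is near `c`. The case `t ≤ s` comes from exchanging the two spikes. -/
theorem exists_separating_of_notMem {p c c' : E} (h : c ∉ segment ℝ p c') :
    ∃ δ > 0, ∀ y y', dist y c < δ → dist y' c' < δ → ∀ t ∈ Set.Icc (0 : ℝ) 1,
      ∀ s ∈ Set.Icc (0 : ℝ) 1, (1 - t) • p + t • y = (1 - s) • p + s • y' → s ≤ t → t = 0 := by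
  obtain ⟨δ, hδ, hdis⟩ := (Set.disjoint_singleton_left.2 h).exists_thickenings
    isCompact_singleton (isCompact_segment p c').isClosed
  refine ⟨δ, hδ, fun y y' hy hy' t ht s hs heq hst => by_contra fun h0 => ?_⟩
  have ht0 : 0 < t := lt_of_le_of_ne ht.1 (Ne.symm h0)
  have hmem : y ∈ Metric.thickening δ {c} := Metric.mem_thickening_iff.2 ⟨c, rfl, hy⟩
  refine Set.disjoint_left.1 hdis hmem ?_
  · have : y = (1 - s / t) • p + (s / t) • y' := by
      have h1 : t • y = t • ((1 - s / t) • p + (s / t) • y') := by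
        rw [smul_add, smul_smul, smul_smul, mul_sub, mul_div_cancel₀ _ h0]
        have : t • y = (1 - s) • p + s • y' - (1 - t) • p := by rw [← heq]; abel
        rw [this]
        module
      exact smul_right_injective E h0 h1
    rw [this]
    exact mem_thickening_segment ⟨div_nonneg hs.1 ht.1, div_le_one_of_le₀ hst ht.1⟩ hy'

variable {V : Type*} [Finite V] [DecidableEq V]

theorem GeneralPosition.exists_separating {𝓕 : Set (Finset V)} {p : V → E}
    (h : GeneralPosition 𝓕 p) :
    ∃ δ > 0, ∀ F ∈ 𝓕, ∀ G ∈ 𝓕, F ≠ G → ∀ v ∈ F, ∀ w ∈ G, ∀ y y',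
      dist y (centroid p F) < δ → dist y' (centroid p G) < δ → ∀ t ∈ Set.Icc (0 : ℝ) 1,
      ∀ s ∈ Set.Icc (0 : ℝ) 1, (1 - t) • p v + t • y = (1 - s) • p w + s • y' →
      v = w ∧ t = 0 ∧ s = 0 := by
  have hloc : ∀ q : Finset V × Finset V × V × V, ∀ᶠ δ in 𝓝[>] (0 : ℝ),
      q.1 ∈ 𝓕 → q.2.1 ∈ 𝓕 → q.1 ≠ q.2.1 → q.2.2.1 ∈ q.1 → q.2.2.2 ∈ q.2.1 → ∀ y y',
      dist y (centroid p q.1) < δ → dist y' (centroid p q.2.1) < δ → ∀ t ∈ Set.Icc (0 : ℝ) 1,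
      ∀ s ∈ Set.Icc (0 : ℝ) 1, (1 - t) • p q.2.2.1 + t • y = (1 - s) • p q.2.2.2 + s • y' →
      q.2.2.1 = q.2.2.2 ∧ t = 0 ∧ s = 0 := by
    rintro ⟨F, G, v, w⟩
    simp only
    by_cases hyp : F ∈ 𝓕 ∧ G ∈ 𝓕 ∧ F ≠ G ∧ v ∈ F ∧ w ∈ G
    · obtain ⟨hF, hG, hFG, hv, hw⟩ := hyp
      by_cases hvw : v = w
      · subst hvw
        obtain ⟨δ₁, hδ₁, h₁⟩ := exists_separating_of_notMem (h.notMem F hF G hG hFG v)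
        obtain ⟨δ₂, hδ₂, h₂⟩ := exists_separating_of_notMem (h.notMem G hG F hF hFG.symm v)
        filter_upwards [Ioo_mem_nhdsGT (lt_min hδ₁ hδ₂)] with δ hδ
        intro _ _ _ _ _ y y' hy hy' t ht s hs heq
        have hlt := lt_min_iff.1 hδ.2
        refine ⟨rfl, ?_⟩
        rcases le_total s t with hst | hst
        · have := h₁ y y' (hy.trans hlt.1) (hy'.trans hlt.1) t ht s hs heq hst
          exact ⟨this, le_antisymm (hst.trans this.le) hs.1⟩
        · have := h₂ y' y (hy'.trans hlt.2) (hy.trans hlt.2) s hs t ht heq.symm hst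
          exact ⟨le_antisymm (hst.trans this.le) ht.1, this⟩
      · obtain ⟨δ₁, hδ₁, h₁⟩ := exists_separating_of_disjoint
          (h.disjoint F hF G hG hFG v hv w hw hvw)
        filter_upwards [Ioo_mem_nhdsGT hδ₁] with δ hδ
        intro _ _ _ _ _ y y' hy hy' t ht s hs heq
        exact absurd heq (h₁ y y' (hy.trans hδ.2) (hy'.trans hδ.2) t ht s hs)
    · exact Eventually.of_forall fun δ hF hG hFG hv hw =>
        absurd ⟨hF, hG, hFG, hv, hw⟩ hyp
  obtain ⟨δ, hδ, hδ0⟩ := ((eventually_all.2 hloc).and self_mem_nhdsWithin).exists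
  exact ⟨δ, hδ0, fun F hF G hG hFG v hv w hw => hδ (F, G, v, w) hF hG hFG hv hw⟩

end Separation

end PLChromatic

namespace PLChromatic

open Finset

/-! ### The barycentric subdivision and its simplexwise linear maps -/

section Barycentric

variable {V : Type*}

/-- The simplices of the barycentric subdivision of `K`: the finite nonempty chains of faces. -/
def chainsOf (K : PreAbstractSimplicialComplex V) : Set (Finset (Finset V)) :=
  {c | c.Nonempty ∧ (∀ σ ∈ c, σ ∈ K.faces) ∧ ∀ σ ∈ c, ∀ τ ∈ c, σ ⊆ τ ∨ τ ⊆ σ}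

theorem exists_top_of_mem_chainsOf {K : PreAbstractSimplicialComplex V} {c : Finset (Finset V)}
    (hc : c ∈ chainsOf K) : ∃ τ ∈ c, ∀ σ ∈ c, σ ⊆ τ := by
  obtain ⟨τ, hτ⟩ := c.exists_maximal hc.1
  refine ⟨τ, hτ.prop, fun σ hσ => ?_⟩
  rcases hc.2.2 σ hσ τ hτ.prop with h | h
  · exact h
  · exact hτ.le_of_ge hσ h

theorem chainsOf_mono {K : PreAbstractSimplicialComplex V} {c c' : Finset (Finset V)}
    (hc : c ∈ chainsOf K) (h : c' ⊆ c) (h' : c'.Nonempty) : c' ∈ chainsOf K :=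
  ⟨h', fun σ hσ => hc.2.1 σ (h hσ), fun σ hσ τ hτ => hc.2.2 σ (h hσ) τ (h hτ)⟩

theorem nonempty_of_mem_chain {K : PreAbstractSimplicialComplex V} {c : Finset (Finset V)}
    (hc : c ∈ chainsOf K) {σ : Finset V} (hσ : σ ∈ c) : σ.Nonempty :=
  (K.isRelLowerSet_faces (hc.2.1 σ hσ)).1

variable {E : Type*} [AddCommGroup E] [Module ℝ E]

theorem centroid_singleton (p : V → E) (v : V) : centroid p {v} = p v := by
  simp [centroid]

theorem centroid_mem_convexHull (p : V → E) {σ : Finset V} (hσ : σ.Nonempty) :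
    centroid p σ ∈ convexHull ℝ (p '' (σ : Set V)) := by
  rw [centroid, smul_sum]
  refine (convex_convexHull ℝ _).sum_mem (fun _ _ => by positivity) ?_
    fun v hv => subset_convexHull ℝ _ ⟨v, hv, rfl⟩
  have : (σ.card : ℝ) ≠ 0 := by simpa using hσ.ne_empty
  simp [this]

/-- The barycenter of the face `σ` in the standard geometric realization. -/
noncomputable def barycenter (σ : Finset V) : V →₀ ℝ :=
  centroid (fun v => Finsupp.single v (1 : ℝ)) σ

theorem mem_faces_realization {K : PreAbstractSimplicialComplex V} {t : Finset (V →₀ ℝ)} :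
    t ∈ (realization K).faces ↔
      ∃ s ∈ K.faces, (t : Set (V →₀ ℝ)) = (fun v => Finsupp.single v (1 : ℝ)) '' (s : Set V) := by
  constructor
  · rintro ⟨s, hs, rfl⟩
    refine ⟨s, hs, ?_⟩
    simp
  · rintro ⟨s, hs, ht⟩
    refine ⟨s, hs, ?_⟩
    rw [← coe_inj, ht]
    simp

theorem convexHull_barycenter_subset {c : Finset (Finset V)} {τ : Finset V}
    (hne : ∀ σ ∈ c, σ.Nonempty) (h : ∀ σ ∈ c, σ ⊆ τ) :
    convexHull ℝ (barycenter '' (c : Set (Finset V))) ⊆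
      convexHull ℝ ((fun v => Finsupp.single v (1 : ℝ)) '' (τ : Set V)) := by
  refine convexHull_min ?_ (convex_convexHull ℝ _)
  rintro _ ⟨σ, hσ, rfl⟩
  exact convexHull_mono (Set.image_mono (coe_subset.2 (h σ hσ)))
    (centroid_mem_convexHull _ (hne σ hσ))

theorem IsChainWeight.of_imp {μ ν : Finset V → ℝ} (hμ : IsChainWeight μ) (h0 : ∀ σ, 0 ≤ ν σ)
    (h : ∀ σ, ν σ ≠ 0 → μ σ ≠ 0) : IsChainWeight ν :=
  ⟨h0, by_contra fun h' => h ∅ h' hμ.empty, fun σ τ hσ hτ => hμ.chain σ τ (h σ hσ) (h τ hτ)⟩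

theorem IsWeight.isChainWeight [Fintype V] {K : PreAbstractSimplicialComplex V} {c : Finset (Finset V)}
    (hc : c ∈ chainsOf K) {μ : Finset V → ℝ} (hμ : IsWeight c μ) : IsChainWeight μ :=
  have hmem : ∀ σ, μ σ ≠ 0 → σ ∈ c := fun σ h => by_contra fun h' => h (hμ.eq_zero σ h')
  ⟨hμ.nonneg, hμ.eq_zero _ fun h => not_nonempty_empty (nonempty_of_mem_chain hc h),
    fun σ τ hσ hτ => hc.2.2 σ (hmem σ hσ) τ (hmem τ hτ)⟩

variable [DecidableEq V]

theorem barycenter_apply (σ : Finset V) (v : V) :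
    barycenter σ v = if v ∈ σ then (σ.card : ℝ)⁻¹ else 0 := by
  simp [barycenter, centroid, Finsupp.single_apply]

theorem support_barycenter (σ : Finset V) : (barycenter σ).support = σ := by
  ext v
  rw [Finsupp.mem_support_iff, barycenter_apply]
  by_cases h : v ∈ σ
  · simp [h, ne_empty_of_mem h]
  · simp [h]

theorem barycenter_injective : Function.Injective (barycenter : Finset V → V →₀ ℝ) :=
  Function.LeftInverse.injective (g := Finsupp.support) support_barycenter

variable [Fintype V]

theorem sum_smul_barycenter_apply (μ : Finset V → ℝ) (v : V) :
    (∑ σ, μ σ • barycenter σ) v = ∑ σ with v ∈ σ, μ σ / σ.card := by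
  simp [Finsupp.finsetSum_apply, barycenter_apply, sum_filter, div_eq_mul_inv]

/-- The coordinate of `∑ μ σ • barycenter σ` at `v` is the sum of `μ σ / σ.card` over `σ ∋ v`, so
uniqueness of chain decompositions applies. -/
theorem uniqueWeights_barycenter (K : PreAbstractSimplicialComplex V) :
    UniqueWeights (chainsOf K) (barycenter : Finset V → V →₀ ℝ) := by
  intro c hc c' hc' μ ν hμ hν h
  have hdiv : ∀ {μ : Finset V → ℝ}, IsChainWeight μ → IsChainWeight fun σ => μ σ / σ.card :=
    fun hμ => hμ.of_imp (fun σ => div_nonneg (hμ.nonneg σ) (Nat.cast_nonneg _))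
      fun σ h h0 => h (by simp [h0])
  have hμc := hμ.isChainWeight hc
  have hνc := hν.isChainWeight hc'
  have key := (hdiv hμc).ext (hdiv hνc) fun v => by
    rw [← sum_smul_barycenter_apply, ← sum_smul_barycenter_apply, h]
  funext σ
  rcases σ.eq_empty_or_nonempty with rfl | hσ
  · rw [hμc.empty, hνc.empty]
  · have : (σ.card : ℝ) ≠ 0 := by simpa using hσ.ne_empty
    exact (div_left_inj' this).1 (congrFun key σ)

theorem UniqueWeights.affineIndependent_image {K : PreAbstractSimplicialComplex V}
    {ψ : Finset V → E} (h : UniqueWeights (chainsOf K) ψ) {c : Finset (Finset V)}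
    (hc : c ∈ chainsOf K) {t : Finset (V →₀ ℝ)} (ht : ∀ x ∈ t, ∃ σ ∈ c, barycenter σ = x) :
    AffineIndependent ℝ (fun x : t => ψ (x : V →₀ ℝ).support) := by
  have hmem : ∀ x ∈ t, x.support ∈ c := by
    intro x hx
    obtain ⟨σ, hσ, rfl⟩ := ht x hx
    rwa [support_barycenter]
  let e : t ↪ c := ⟨fun x => ⟨x.1.support, hmem x x.2⟩, fun x y hxy => by
    obtain ⟨σ, -, hσ⟩ := ht x x.2
    obtain ⟨τ, -, hτ⟩ := ht y y.2
    have hs : x.1.support = y.1.support := congrArg Subtype.val hxy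
    rw [← hσ, ← hτ, support_barycenter, support_barycenter] at hs
    exact Subtype.ext (by rw [← hσ, ← hτ, hs])⟩
  exact (h.affineIndependent hc).comp_embedding e

open Classical in
/-- The barycentric subdivision of the standard geometric realization of `K`. -/
noncomputable def barycentricSubdivision (K : PreAbstractSimplicialComplex V) :
    Geometry.SimplicialComplex ℝ (V →₀ ℝ) where
  faces := (fun c => c.image barycenter) '' chainsOf K
  isRelLowerSet_faces := by
    rintro _ ⟨c, hc, rfl⟩
    refine ⟨hc.1.image _, fun t ht htn => ?_⟩
    obtain ⟨c', hc', rfl⟩ := subset_image_iff.1 ht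
    exact ⟨c', chainsOf_mono hc hc' (image_nonempty.1 htn), rfl⟩
  indep := by
    rintro _ ⟨c, hc, rfl⟩
    have hex : ∀ x ∈ c.image barycenter, ∃ σ ∈ c, barycenter σ = x := fun x hx => mem_image.1 hx
    convert! (uniqueWeights_barycenter K).affineIndependent_image hc hex using 1
    funext x
    obtain ⟨σ, -, hσ⟩ := hex x x.2
    rw [← hσ, support_barycenter]
  inter_subset_convexHull := by
    rintro _ _ ⟨c, hc, rfl⟩ ⟨c', hc', rfl⟩
    simp only [coe_image]
    rw [(uniqueWeights_barycenter K).convexHull_inter hc hc',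
      Set.image_inter barycenter_injective]

/-- Decompose the barycentric coordinates of `x` into layers `κ`. Since `barycenter σ` is the
indicator of `σ` divided by `σ.card`, the weights are `κ σ * σ.card`. -/
theorem exists_chain_of_mem_convexHull {K : PreAbstractSimplicialComplex V} {s : Finset V}
    (hs : s ∈ K.faces) {x : V →₀ ℝ}
    (hx : x ∈ convexHull ℝ ((fun v => Finsupp.single v (1 : ℝ)) '' (s : Set V))) :
    ∃ c ∈ chainsOf K, x ∈ convexHull ℝ (barycenter '' (c : Set (Finset V))) := by
  obtain ⟨g, hg, rfl⟩ := mem_convexHull_image_iff.1 hx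
  obtain ⟨κ, hκ, hsum, hsupp⟩ := exists_isChainWeight g hg.nonneg
  have htot : ∑ σ, κ σ * σ.card = 1 := by
    rw [← hg.sum_eq]
    simp_rw [← hsum, sum_filter]
    rw [sum_comm]
    refine sum_congr rfl fun σ _ => ?_
    rw [← sum_filter, sum_const, nsmul_eq_mul, mul_comm]
    simp
  have hc : (univ.filter fun σ => κ σ ≠ 0) ∈ chainsOf K := by
    refine ⟨?_, fun σ hσ => ?_, fun σ hσ τ hτ =>
      hκ.chain σ τ (by simpa using hσ) (by simpa using hτ)⟩
    · rw [nonempty_iff_ne_empty]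
      intro h0
      have hz : ∀ σ, κ σ = 0 := fun σ => by simpa using (filter_eq_empty_iff.1 h0) (mem_univ σ)
      simp [hz] at htot
    · have hσ' : κ σ ≠ 0 := by simpa using hσ
      refine (K.isRelLowerSet_faces hs).2 (fun v hv => ?_) ?_
      · by_contra h
        exact hsupp σ hσ' v hv (hg.eq_zero v h)
      · rw [nonempty_iff_ne_empty]
        rintro rfl
        exact hσ' hκ.empty
  refine ⟨_, hc, mem_convexHull_image_iff.2 ⟨fun σ => κ σ * σ.card,
    ⟨fun σ => mul_nonneg (hκ.nonneg σ) (Nat.cast_nonneg _), fun σ hσ => ?_, htot⟩, ?_⟩⟩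
  · have : κ σ = 0 := by simpa using hσ
    simp [this]
  · ext v
    rw [sum_smul_barycenter_apply]
    have h1 : (∑ a, g a • Finsupp.single a (1 : ℝ)) v = g v := by
      simp [Finsupp.finsetSum_apply, Finsupp.single_apply]
    rw [h1, ← hsum v]
    refine sum_congr rfl fun σ hσ => ?_
    have hv : v ∈ σ := by simpa using hσ
    have : (σ.card : ℝ) ≠ 0 := by simpa using ne_empty_of_mem hv
    field_simp

theorem isSubdivision_barycentricSubdivision (K : PreAbstractSimplicialComplex V) :
    IsSubdivision (barycentricSubdivision K) (realization K) := by
  classical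
  have hface : ∀ t ∈ (barycentricSubdivision K).faces, ∃ c ∈ chainsOf K,
      (t : Set (V →₀ ℝ)) = barycenter '' (c : Set (Finset V)) := by
    rintro _ ⟨c, hc, rfl⟩
    exact ⟨c, hc, by simp⟩
  have hsub : ∀ t ∈ (barycentricSubdivision K).faces, ∃ u ∈ (realization K).faces,
      convexHull ℝ (t : Set (V →₀ ℝ)) ⊆ convexHull ℝ (u : Set (V →₀ ℝ)) := by
    intro t ht
    obtain ⟨c, hc, htc⟩ := hface t ht
    obtain ⟨τ, hτ, htop⟩ := exists_top_of_mem_chainsOf hc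
    refine ⟨τ.image fun v => Finsupp.single v 1, mem_faces_realization.2
      ⟨τ, hc.2.1 τ hτ, by simp⟩, ?_⟩
    rw [htc, coe_image]
    exact convexHull_barycenter_subset (fun σ hσ => nonempty_of_mem_chain hc hσ) htop
  refine ⟨Set.Subset.antisymm ?_ ?_, hsub, fun t _ => Set.Finite.subset ?_ fun s hs => hs.1⟩
  · intro x hx
    obtain ⟨t, ht, hxt⟩ := Geometry.SimplicialComplex.mem_space_iff.1 hx
    obtain ⟨u, hu, htu⟩ := hsub t ht
    exact Geometry.SimplicialComplex.mem_space_iff.2 ⟨u, hu, htu hxt⟩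
  · intro x hx
    obtain ⟨t, ht, hxt⟩ := Geometry.SimplicialComplex.mem_space_iff.1 hx
    obtain ⟨s, hs, hts⟩ := mem_faces_realization.1 ht
    rw [hts] at hxt
    obtain ⟨c, hc, hxc⟩ := exists_chain_of_mem_convexHull hs hxt
    exact Geometry.SimplicialComplex.mem_space_iff.2 ⟨_, ⟨c, hc, rfl⟩, by simpa using hxc⟩
  · exact (Set.toFinite (chainsOf K)).image _

/-- A barycenter determines its face as its support, so `ψ` on faces becomes a placement of the
vertices of the subdivision. -/
theorem plEmbeddable_of_uniqueWeights {K : PreAbstractSimplicialComplex V} {d : ℕ}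
    {ψ : Finset V → EuclideanSpace ℝ (Fin d)} (h : UniqueWeights (chainsOf K) ψ) :
    PLEmbeddable K d := by
  classical
  have himage : ∀ s : Set (Finset V),
      (fun x : V →₀ ℝ => ψ x.support) '' (barycenter '' s) = ψ '' s := by
    intro s
    rw [Set.image_image]
    simp only [support_barycenter]
  refine ⟨barycentricSubdivision K, isSubdivision_barycentricSubdivision K,
    fun x => ψ x.support, ?_, ?_⟩
  · rintro _ ⟨c, hc, rfl⟩
    exact h.affineIndependent_image hc fun x hx => by simpa using hx
  · rintro _ ⟨c, hc, rfl⟩ _ ⟨c', hc', rfl⟩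
    simp only [coe_image]
    rw [← Set.image_inter barycenter_injective, himage, himage, himage, h.convexHull_inter hc hc']

end Barycentric

end PLChromatic

namespace PLChromatic

open Finset

/-! ### Contracting facets to spikes -/

section Spikes

variable {V : Type*} {E : Type*} [AddCommGroup E] [Module ℝ E]

/-- The image of the barycenter of the face `σ` of the facet `F`: vertices are fixed, and all other
barycenters are contracted by the factor `ε` towards the centroid of `F`. -/
noncomputable def spikePoint (p : V → E) (ε : ℝ) (F σ : Finset V) : E :=
  if 1 < σ.card then centroid p F + ε • (centroid p σ - centroid p F) else centroid p σ

open Classical in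
/-- The map on barycenters which restricts to `spikePoint p ε F` on every facet `F`. -/
noncomputable def spikeMap (p : V → E) (ε : ℝ) (𝓕 : Set (Finset V)) (σ : Finset V) : E :=
  if h : ∃ F ∈ 𝓕, σ ⊆ F ∧ 1 < σ.card then spikePoint p ε h.choose σ else centroid p σ

/-- A face with at least two vertices lies in a unique facet, so the chosen facet is `F`; smaller
faces do not depend on the choice. -/
theorem spikeMap_eq [DecidableEq V] {p : V → E} {ε : ℝ} {𝓕 : Set (Finset V)}
    (hlin : ∀ F ∈ 𝓕, ∀ G ∈ 𝓕, F ≠ G → (F ∩ G).card ≤ 1) {F σ : Finset V} (hF : F ∈ 𝓕)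
    (hσ : σ ⊆ F) : spikeMap p ε 𝓕 σ = spikePoint p ε F σ := by
  by_cases h1 : 1 < σ.card
  · have h : ∃ F ∈ 𝓕, σ ⊆ F ∧ 1 < σ.card := ⟨F, hF, hσ, h1⟩
    rw [spikeMap, dif_pos h]
    congr 1
    by_contra hne
    have := hlin _ h.choose_spec.1 F hF hne
    have := card_le_card (subset_inter h.choose_spec.2.1 hσ)
    omega
  · rw [spikeMap, dif_neg (by rintro ⟨_, _, _, h⟩; exact h1 h), spikePoint, if_neg h1]

/-- A chain of faces of `F` has at most one singleton member. -/
theorem exists_apex {K : PreAbstractSimplicialComplex V} {c : Finset (Finset V)}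
    (hc : c ∈ chainsOf K) {F : Finset V} (hF : F.Nonempty) (hcF : ∀ σ ∈ c, σ ⊆ F) :
    ∃ v ∈ F, ∀ σ ∈ c, ¬ 1 < σ.card → σ = {v} := by
  have hsing : ∀ σ ∈ c, ¬ 1 < σ.card → ∃ v, σ = {v} := by
    intro σ hσ h
    have := (nonempty_of_mem_chain hc hσ).card_pos
    exact card_eq_one.1 (by omega)
  by_cases h : ∃ σ ∈ c, ¬ 1 < σ.card
  · obtain ⟨σ, hσ, h1⟩ := h
    obtain ⟨v, rfl⟩ := hsing σ hσ h1
    refine ⟨v, hcF _ hσ (mem_singleton_self v), fun τ hτ hτ1 => ?_⟩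
    obtain ⟨w, rfl⟩ := hsing τ hτ hτ1
    rcases hc.2.2 _ hσ _ hτ with h | h
    · rw [singleton_subset_singleton.1 h]
    · rw [singleton_subset_singleton.1 h]
  · push Not at h
    obtain ⟨v, hv⟩ := hF
    exact ⟨v, hv, fun σ hσ h1 => absurd (h σ hσ) h1⟩

/-- The mass that `μ` gives to the sets with more than one element. -/
noncomputable def coreMass [Fintype V] (μ : Finset V → ℝ) : ℝ :=
  ∑ σ with 1 < σ.card, μ σ

section Convex

variable [Fintype V]

theorem coreMass_nonneg {μ : Finset V → ℝ} (h : ∀ σ, 0 ≤ μ σ) : 0 ≤ coreMass μ :=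
  sum_nonneg fun σ _ => h σ

theorem IsWeight.coreMass_le_one {c : Finset (Finset V)} {μ : Finset V → ℝ}
    (hμ : IsWeight c μ) : coreMass μ ≤ 1 := by
  rw [← hμ.sum_eq]
  exact sum_le_sum_of_subset_of_nonneg (filter_subset _ _) fun σ _ _ => hμ.nonneg σ

theorem IsWeight.sum_eq_one_sub_coreMass {c : Finset (Finset V)} {μ : Finset V → ℝ}
    (hμ : IsWeight c μ) : ∑ σ with ¬ 1 < σ.card, μ σ = 1 - coreMass μ := by
  rw [← hμ.sum_eq, coreMass, ← sum_filter_add_sum_filter_not univ (fun σ : Finset V => 1 < σ.card)]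
  ring

theorem IsWeight.eq_single [DecidableEq V] {c : Finset (Finset V)} {μ : Finset V → ℝ}
    (hμ : IsWeight c μ)
    {v : V} (hv : ∀ σ ∈ c, ¬ 1 < σ.card → σ = {v}) (h0 : coreMass μ = 0) :
    μ = Pi.single {v} 1 := by
  have hz : ∀ σ, σ ≠ {v} → μ σ = 0 := by
    intro σ hσ
    by_cases hc : σ ∈ c
    · have h1 : 1 < σ.card := by_contra fun h => hσ (hv σ hc h)
      exact (sum_eq_zero_iff_of_nonneg fun σ _ => hμ.nonneg σ).1 h0 σ (by simpa using h1)
    · exact hμ.eq_zero σ hc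
  funext σ
  by_cases h : σ = {v}
  · subst h
    rw [Pi.single_eq_same, ← hμ.sum_eq, sum_eq_single {v} (fun σ _ h => hz σ h) (by simp)]
  · rw [hz σ h, Pi.single_eq_of_ne h]

/-- Only the apex `v` escapes the contraction, and the contracted points lie in the convex `δ`-ball
about the centroid. The image is thus on a segment from `p v` into that ball, with parameter the
core mass. -/
theorem IsWeight.sum_spikePoint_mem {E : Type*} [NormedAddCommGroup E] [NormedSpace ℝ E]
    {p : V → E} {ε δ : ℝ} {F : Finset V} (hδ : 0 < δ)
    (hε : ∀ σ, ‖ε • (centroid p σ - centroid p F)‖ < δ) {c : Finset (Finset V)}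
    {μ : Finset V → ℝ} (hμ : IsWeight c μ) {v : V}
    (hv : ∀ σ ∈ c, ¬ 1 < σ.card → σ = {v}) :
    ∃ y, dist y (centroid p F) < δ ∧
      ∑ σ, μ σ • spikePoint p ε F σ = (1 - coreMass μ) • p v + coreMass μ • y := by
  have h1 : ∑ σ with ¬ 1 < σ.card, μ σ • spikePoint p ε F σ = (1 - coreMass μ) • p v := by
    rw [← hμ.sum_eq_one_sub_coreMass, sum_smul]
    refine sum_congr rfl fun σ hσ => ?_
    have hσ1 : ¬ 1 < σ.card := (mem_filter.1 hσ).2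
    by_cases hc : σ ∈ c
    · rw [spikePoint, if_neg hσ1, hv σ hc hσ1, centroid_singleton]
    · simp [hμ.eq_zero σ hc]
  have hsplit : ∑ σ, μ σ • spikePoint p ε F σ = (1 - coreMass μ) • p v +
      ∑ σ with 1 < σ.card, μ σ • spikePoint p ε F σ := by
    rw [← h1, add_comm, sum_filter_add_sum_filter_not]
  by_cases h0 : coreMass μ = 0
  · refine ⟨centroid p F, by simpa using hδ, ?_⟩
    rw [hsplit, h0, zero_smul]
    congr 1
    refine sum_eq_zero fun σ hσ => ?_
    rw [(sum_eq_zero_iff_of_nonneg fun σ _ => hμ.nonneg σ).1 h0 σ hσ, zero_smul]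
  · refine ⟨∑ σ with 1 < σ.card, ((coreMass μ)⁻¹ * μ σ) • spikePoint p ε F σ, ?_, ?_⟩
    · rw [← Metric.mem_ball]
      refine (convex_ball (centroid p F) δ).sum_mem (fun σ _ => mul_nonneg
        (inv_nonneg.2 (coreMass_nonneg hμ.nonneg)) (hμ.nonneg σ)) ?_ fun σ hσ => ?_
      · rw [← mul_sum]
        exact inv_mul_cancel₀ h0
      · rw [spikePoint, if_pos (mem_filter.1 hσ).2, Metric.mem_ball, dist_self_add_left]
        exact hε σ
    · rw [hsplit, smul_sum]
      congr 1
      refine sum_congr rfl fun σ _ => ?_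
      rw [smul_smul, mul_inv_cancel_left₀ h0]

end Convex

variable [DecidableEq V]

/-- The weights which express a combination of the points `spikePoint p ε F σ` as a combination of
the points `∑ v ∈ σ, p v`. -/
noncomputable def spikeWeight [Fintype V] (ε : ℝ) (F : Finset V) (μ : Finset V → ℝ)
    (σ : Finset V) : ℝ :=
  (if 1 < σ.card then ε * μ σ / σ.card else μ σ) +
    if σ = F then (1 - ε) * coreMass μ / F.card else 0

variable [Fintype V]

/-- Contraction keeps a fraction `ε` of each core weight on its own set and moves the rest to `F`.
The new weights still sit on a chain, as `F` contains every set used. -/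
theorem sum_spikePoint (p : V → E) (ε : ℝ) (F : Finset V) {μ : Finset V → ℝ} (hμ : μ ∅ = 0) :
    ∑ σ, μ σ • spikePoint p ε F σ =
      ∑ v, (∑ σ with v ∈ σ, spikeWeight ε F μ σ) • p v := by
  have h1 : ∑ v, (∑ σ with v ∈ σ, spikeWeight ε F μ σ) • p v =
      ∑ σ, spikeWeight ε F μ σ • ∑ v ∈ σ, p v := by
    simp_rw [sum_smul, sum_filter]
    rw [sum_comm]
    refine sum_congr rfl fun σ _ => ?_
    rw [← sum_filter, smul_sum]
    exact sum_congr (by simp) fun _ _ => rfl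
  have h2 : ∀ σ, μ σ • spikePoint p ε F σ =
      (if 1 < σ.card then ε * μ σ / σ.card else μ σ) • ∑ v ∈ σ, p v +
        if 1 < σ.card then μ σ • ((1 - ε) / F.card) • ∑ v ∈ F, p v else 0 := by
    intro σ
    by_cases h : 1 < σ.card
    · simp only [spikePoint, h, if_true, centroid, div_eq_mul_inv]
      module
    · rcases σ.eq_empty_or_nonempty with rfl | hσ
      · simp [hμ]
      · have hσ1 : σ.card = 1 := by have := hσ.card_pos; omega
        simp [spikePoint, centroid, hσ1]
  rw [h1, sum_congr rfl fun σ _ => h2 σ, sum_add_distrib]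
  simp only [spikeWeight, add_smul, sum_add_distrib]
  congr 1
  rw [← sum_filter, ← sum_smul, ← coreMass, smul_smul]
  simp only [ite_smul, zero_smul, sum_ite_eq', mem_univ, if_true]
  congr 1
  ring

theorem spikeWeight_ne_zero {ε : ℝ} {F : Finset V} {μ : Finset V → ℝ} {σ : Finset V}
    (h : spikeWeight ε F μ σ ≠ 0) : σ = F ∨ μ σ ≠ 0 := by
  by_contra! h'
  exact h (by simp [spikeWeight, h'.1, h'.2])

theorem IsWeight.spikeWeight {K : PreAbstractSimplicialComplex V} {c : Finset (Finset V)}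
    (hc : c ∈ chainsOf K) {F : Finset V} (hF : F.Nonempty) (hcF : ∀ σ ∈ c, σ ⊆ F)
    {μ : Finset V → ℝ} (hμ : IsWeight c μ) {ε : ℝ} (hε0 : 0 ≤ ε) (hε1 : ε ≤ 1) :
    IsChainWeight (spikeWeight ε F μ) := by
  have hμc := hμ.isChainWeight hc
  have hsub : ∀ σ, μ σ ≠ 0 → σ ⊆ F := fun σ h =>
    hcF σ (by_contra fun h' => h (hμ.eq_zero σ h'))
  refine ⟨fun σ => ?_, ?_, fun σ τ hσ hτ => ?_⟩
  · have h1 := hμ.nonneg σ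
    have h2 := coreMass_nonneg hμ.nonneg
    have h3 : 0 ≤ 1 - ε := sub_nonneg.2 hε1
    unfold PLChromatic.spikeWeight
    split_ifs <;> positivity
  · simp [PLChromatic.spikeWeight, hμc.empty, hF.ne_empty.symm]
  · rcases spikeWeight_ne_zero hσ with rfl | hσ'
    · rcases spikeWeight_ne_zero hτ with rfl | hτ'
      · exact Or.inl le_rfl
      · exact Or.inr (hsub τ hτ')
    · rcases spikeWeight_ne_zero hτ with rfl | hτ'
      · exact Or.inl (hsub σ hσ')
      · exact hμc.chain σ τ hσ' hτ'

/-- On the subdivision of a single nondegenerate facet, the weights are determined. -/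
theorem eq_of_sum_spikePoint_eq {K : PreAbstractSimplicialComplex V} {p : V → E} {F : Finset V}
    (hF : 1 < F.card)
    (hind : ∀ w : V → ℝ, ∑ v ∈ F, w v = 0 → ∑ v ∈ F, w v • p v = 0 → ∀ v ∈ F, w v = 0)
    {ε : ℝ} (hε0 : 0 < ε) (hε1 : ε ≤ 1) {c c' : Finset (Finset V)} (hc : c ∈ chainsOf K)
    (hc' : c' ∈ chainsOf K) (hcF : ∀ σ ∈ c, σ ⊆ F) (hcF' : ∀ σ ∈ c', σ ⊆ F) {μ ν : Finset V → ℝ}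
    (hμ : IsWeight c μ) (hν : IsWeight c' ν)
    (h : ∑ σ, μ σ • spikePoint p ε F σ = ∑ σ, ν σ • spikePoint p ε F σ) : μ = ν := by
  have hF0 : F.Nonempty := card_pos.1 (by omega)
  let g : (Finset V → ℝ) → V → ℝ := fun μ v => ∑ σ with v ∈ σ, spikeWeight ε F μ σ
  have hg0 : ∀ {c : Finset (Finset V)} {μ : Finset V → ℝ}, (∀ σ ∈ c, σ ⊆ F) → IsWeight c μ →
      ∀ v, v ∉ F → g μ v = 0 := by
    intro c μ hcF hμ v hv
    refine sum_eq_zero fun σ hσ => by_contra fun h => hv ?_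
    have hvσ : v ∈ σ := by simpa using hσ
    rcases spikeWeight_ne_zero h with rfl | h'
    · exact hvσ
    · exact hcF σ (by_contra fun h => h' (hμ.eq_zero σ h)) hvσ
  have hg1 : ∀ {c : Finset (Finset V)} {μ : Finset V → ℝ}, c ∈ chainsOf K → IsWeight c μ →
      ∑ v, g μ v = 1 := by
    intro c μ hc hμ
    have hμ0 := (hμ.isChainWeight hc).empty
    have hcard : ∀ σ : Finset V, σ.Nonempty → centroid (fun _ : V => (1 : ℝ)) σ = 1 := by
      intro σ hσ
      have : (σ.card : ℝ) ≠ 0 := by simpa using hσ.ne_empty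
      simp [centroid, this]
    -- Applied to the constant map `1`, the identity computes the total of the vertex coefficients.
    have := sum_spikePoint (fun _ : V => (1 : ℝ)) ε F hμ0
    simp only [smul_eq_mul, mul_one] at this
    refine this.symm.trans (Eq.trans ?_ hμ.sum_eq)
    refine sum_congr rfl fun σ _ => ?_
    rcases σ.eq_empty_or_nonempty with rfl | hσ
    · simp [hμ0]
    · simp [spikePoint, hcard F hF0, hcard σ hσ]
  have hsupp : ∀ v, v ∉ F → g μ v - g ν v = 0 := fun v hv => by
    rw [hg0 hcF hμ v hv, hg0 hcF' hν v hv, sub_zero]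
  rw [sum_spikePoint p ε F (hμ.isChainWeight hc).empty,
    sum_spikePoint p ε F (hν.isChainWeight hc').empty] at h
  have hgeq := hind (fun v => g μ v - g ν v)
    (by rw [sum_subset (subset_univ F) fun v _ hv => hsupp v hv, sum_sub_distrib, hg1 hc hμ,
      hg1 hc' hν, sub_self])
    (by rw [sum_subset (subset_univ F) fun v _ hv => by rw [hsupp v hv, zero_smul]]
        simp only [sub_smul, sum_sub_distrib, g]
        rw [h, sub_self])
  have hw := (hμ.spikeWeight hc hF0 hcF hε0.le hε1).ext (hν.spikeWeight hc' hF0 hcF' hε0.le hε1)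
    fun v => by
      by_cases hv : v ∈ F
      · exact sub_eq_zero.1 (hgeq v hv)
      · exact sub_eq_zero.1 (hsupp v hv)
  -- Undo `spikeWeight`: sets with at most one element keep their weight, which fixes the core mass
  -- and so the extra term at `F`; the rest is division by `ε`.
  have hsmall : ∀ σ : Finset V, ¬ 1 < σ.card → μ σ = ν σ := by
    intro σ hσ
    have hσF : σ ≠ F := by rintro rfl; exact hσ hF
    simpa [spikeWeight, hσ, hσF] using congrFun hw σ
  have hmass : coreMass μ = coreMass ν := by
    have h1 := hμ.sum_eq_one_sub_coreMass
    rw [sum_congr rfl fun σ hσ => hsmall σ (mem_filter.1 hσ).2, hν.sum_eq_one_sub_coreMass] at h1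
    linarith
  funext σ
  by_cases hσ : 1 < σ.card
  · have hσ0 : (σ.card : ℝ) ≠ 0 := by positivity
    have := congrFun hw σ
    simp only [spikeWeight, hσ, if_true, hmass, add_left_inj] at this
    rw [div_left_inj' hσ0] at this
    exact mul_left_cancel₀ hε0.ne' this
  · exact hsmall σ hσ

end Spikes

/-! ### Embedding complexes with almost disjoint facets -/

section Embedding

variable {V : Type*}

/-- The simplicial complex with the given facets. -/
def complexOf (𝓕 : Set (Finset V)) : PreAbstractSimplicialComplex V where
  faces := {s | s.Nonempty ∧ ∃ F ∈ 𝓕, s ⊆ F}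
  isRelLowerSet_faces := by
    rintro s ⟨hs, F, hF, hsF⟩
    exact ⟨hs, fun t ht htn => ⟨htn, F, hF, ht.trans hsF⟩⟩

theorem exists_scale [Finite V] {E : Type*} [NormedAddCommGroup E] [NormedSpace ℝ E] (p : V → E)
    {δ : ℝ} (hδ : 0 < δ) : ∃ ε : ℝ, 0 < ε ∧ ε ≤ 1 ∧
      ∀ F σ : Finset V, ‖ε • (centroid p σ - centroid p F)‖ < δ := by
  obtain ⟨R, hR⟩ := (Set.finite_range fun q : Finset V × Finset V =>
    ‖centroid p q.2 - centroid p q.1‖).bddAbove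
  have hR' : ∀ F σ : Finset V, ‖centroid p σ - centroid p F‖ ≤ R := fun F σ => hR ⟨(F, σ), rfl⟩
  have hR0 : 0 ≤ R := (norm_nonneg _).trans (hR' ∅ ∅)
  have hε : 0 < min 1 (δ / (R + 1)) := by positivity
  refine ⟨_, hε, min_le_left _ _, fun F σ => ?_⟩
  rw [norm_smul, Real.norm_of_nonneg hε.le]
  calc min 1 (δ / (R + 1)) * ‖centroid p σ - centroid p F‖ ≤ δ / (R + 1) * R :=
        mul_le_mul (min_le_right _ _) (hR' F σ) (norm_nonneg _) (by positivity)
    _ < δ / (R + 1) * (R + 1) := by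
        have : 0 < δ / (R + 1) := by positivity
        nlinarith
    _ = δ := by field_simp

/-- A pure `d`-dimensional complex whose facets pairwise share at most one vertex is PL embeddable
in `ℝ^d`, for `d ≥ 3`. -/
theorem plEmbeddable_complexOf [Finite V] [DecidableEq V] {d : ℕ} (hd : 3 ≤ d)
    {𝓕 : Set (Finset V)} (hcard : ∀ F ∈ 𝓕, F.card = d + 1)
    (hlin : ∀ F ∈ 𝓕, ∀ G ∈ 𝓕, F ≠ G → (F ∩ G).card ≤ 1) :
    PLEmbeddable (complexOf 𝓕) d := by
  have := Fintype.ofFinite V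
  obtain ⟨p, hp⟩ := exists_generalPosition hd hcard hlin
  obtain ⟨δ, hδ, hsep⟩ := hp.exists_separating
  obtain ⟨ε, hε0, hε1, hε⟩ := exists_scale p hδ
  have hfacet : ∀ c ∈ chainsOf (complexOf 𝓕), ∃ F ∈ 𝓕, ∀ σ ∈ c, σ ⊆ F := by
    intro c hc
    obtain ⟨τ, hτ, htop⟩ := exists_top_of_mem_chainsOf hc
    obtain ⟨-, F, hF, hτF⟩ := hc.2.1 τ hτ
    exact ⟨F, hF, fun σ hσ => (htop σ hσ).trans hτF⟩
  have hspike : ∀ {c : Finset (Finset V)} {F : Finset V} {μ : Finset V → ℝ}, F ∈ 𝓕 →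
      (∀ σ ∈ c, σ ⊆ F) → IsWeight c μ →
      ∑ σ, μ σ • spikeMap p ε 𝓕 σ = ∑ σ, μ σ • spikePoint p ε F σ := by
    intro c F μ hF hcF hμ
    refine sum_congr rfl fun σ _ => ?_
    by_cases hσ : σ ∈ c
    · rw [spikeMap_eq hlin hF (hcF σ hσ)]
    · rw [hμ.eq_zero σ hσ, zero_smul, zero_smul]
  refine plEmbeddable_of_uniqueWeights (ψ := spikeMap p ε 𝓕) ?_
  intro c hc c' hc' μ ν hμ hν h
  obtain ⟨F, hF, hcF⟩ := hfacet c hc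
  obtain ⟨G, hG, hcG⟩ := hfacet c' hc'
  have hFcard := hcard F hF
  have hGcard := hcard G hG
  rw [hspike hF hcF hμ, hspike hG hcG hν] at h
  by_cases hFG : F = G
  · subst hFG
    exact eq_of_sum_spikePoint_eq (by omega) (hp.indep F hF) hε0 hε1 hc hc' hcF hcG hμ hν h
  · obtain ⟨v, hvF, hv⟩ := exists_apex hc (card_pos.1 (by omega)) hcF
    obtain ⟨w, hwG, hw⟩ := exists_apex hc' (card_pos.1 (by omega)) hcG
    obtain ⟨y, hy, hys⟩ := hμ.sum_spikePoint_mem hδ (hε F) hv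
    obtain ⟨y', hy', hys'⟩ := hν.sum_spikePoint_mem hδ (hε G) hw
    rw [hys, hys'] at h
    obtain ⟨rfl, h1, h2⟩ := hsep F hF G hG hFG v hvF w hwG y y' hy hy' _
      ⟨coreMass_nonneg hμ.nonneg, hμ.coreMass_le_one⟩ _
      ⟨coreMass_nonneg hν.nonneg, hν.coreMass_le_one⟩ h
    rw [hμ.eq_single hv h1, hν.eq_single hw h2]

end Embedding

/-! ### Combinatorial lines as a linear hypergraph -/

section HalesJewett

open Combinatorics

variable {α ι : Type*}

theorem line_injective (l : Line α ι) : Function.Injective l := by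
  intro a b hab
  obtain ⟨i, hi⟩ := l.proper
  simpa [hi] using congrFun hab i

/-- Where `l` is active, `l'` is too, since a fixed coordinate would force `a = b`. Hence `a = a'`,
and the same comparison at every coordinate identifies the lines. -/
theorem line_eq_of_two_common {l l' : Line α ι} {a b a' b' : α} (hab : a ≠ b)
    (ha : l a = l' a') (hb : l b = l' b') : l = l' := by
  have ha'b' : a' ≠ b' := by
    rintro rfl
    exact hab (line_injective l (ha.trans hb.symm))
  have key : ∀ i, (l.idxFun i).getD a = (l'.idxFun i).getD a' ∧
      (l.idxFun i).getD b = (l'.idxFun i).getD b' := fun i => ⟨congrFun ha i, congrFun hb i⟩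
  have haa : a = a' := by
    obtain ⟨i, hi⟩ := l.proper
    have h := key i
    cases hi' : l'.idxFun i with
    | none => simpa [hi, hi'] using h.1
    | some x =>
      simp only [hi, hi', Option.getD_none, Option.getD_some] at h
      exact absurd (h.1.trans h.2.symm) hab
  subst haa
  ext1
  funext i
  have h := key i
  cases hi : l.idxFun i with
  | none =>
    cases hi' : l'.idxFun i with
    | none => rfl
    | some x =>
      simp only [hi, hi', Option.getD_none, Option.getD_some] at h
      exact absurd (h.1.trans h.2.symm) hab
  | some x =>
    cases hi' : l'.idxFun i with
    | none =>
      simp only [hi, hi', Option.getD_none, Option.getD_some] at h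
      exact absurd (h.1.symm.trans h.2) ha'b'
    | some y => simpa [hi, hi'] using h.1

/-- The points of a combinatorial line. -/
def linePoints [Fintype α] (l : Line α ι) : Finset (ι → α) :=
  univ.map ⟨l, line_injective l⟩

theorem card_linePoints [Fintype α] (l : Line α ι) : (linePoints l).card = Fintype.card α := by
  simp [linePoints]

theorem mem_linePoints [Fintype α] {l : Line α ι} {x : ι → α} :
    x ∈ linePoints l ↔ ∃ a, l a = x := by
  simp [linePoints]

theorem card_linePoints_inter_le_one [Fintype α] [DecidableEq (ι → α)] {l l' : Line α ι}
    (h : linePoints l ≠ linePoints l') : (linePoints l ∩ linePoints l').card ≤ 1 := by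
  rw [card_le_one]
  intro x hx y hy
  by_contra hxy
  simp only [mem_inter, mem_linePoints] at hx hy
  obtain ⟨⟨a, rfl⟩, a', ha⟩ := hx
  obtain ⟨⟨b, rfl⟩, b', hb⟩ := hy
  exact h (by rw [line_eq_of_two_common (fun hab => hxy (by rw [hab])) ha.symm hb.symm])

end HalesJewett

/-! ### Facet hypergraphs and the chromatic lower bound -/

section FacetHypergraph

variable {V : Type*}

/-- The hypergraph with the given hyperedges, whose vertices are those covered by a hyperedge. -/
def hypergraphOf (𝓕 : Set (Finset V)) : Hypergraph V where
  vertexSet := {v | ∃ F ∈ 𝓕, v ∈ F}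
  edgeSet := {e | ∃ F ∈ 𝓕, e = (F : Set V)}
  subset_vertexSet_of_mem_edgeSet' := by
    rintro _ ⟨F, hF, rfl⟩ v hv
    exact ⟨F, hF, hv⟩

theorem isUniform_hypergraphOf {𝓕 : Set (Finset V)} {k : ℕ} (hcard : ∀ F ∈ 𝓕, F.card = k) :
    IsUniform (hypergraphOf 𝓕) k := by
  rintro _ ⟨F, hF, rfl⟩
  rw [Set.encard_coe_eq_coe_finsetCard, hcard F hF]

theorem isFacetHypergraph_hypergraphOf {𝓕 : Set (Finset V)} {k : ℕ} (hk : 0 < k)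
    (hcard : ∀ F ∈ 𝓕, F.card = k) : IsFacetHypergraph (hypergraphOf 𝓕) (complexOf 𝓕) := by
  have hface : ∀ F ∈ 𝓕, F ∈ (complexOf 𝓕).faces := fun F hF =>
    ⟨card_pos.1 (by rw [hcard F hF]; exact hk), F, hF, subset_rfl⟩
  constructor
  · ext v
    simp [hypergraphOf, complexOf]
  · ext e
    constructor
    · rintro ⟨F, hF, rfl⟩
      refine ⟨F, ⟨hface F hF, ?_⟩, rfl⟩
      rintro t ⟨-, G, hG, htG⟩ hFt
      refine (eq_of_subset_of_card_le hFt ?_).ge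
      rw [hcard F hF, ← hcard G hG]
      exact card_le_card htG
    · rintro ⟨s, hs, rfl⟩
      obtain ⟨-, F, hF, hsF⟩ := hs.prop
      exact ⟨F, hF, by rw [hs.eq_of_le (hface F hF) hsF]⟩

theorem le_weakChromaticNumber {H : Hypergraph V} {m : ℕ}
    (hne : ∀ e ∈ H.edgeSet, e.Nonempty) (h : ¬ WeaklyColorable H m) :
    (m : ℕ∞) ≤ weakChromaticNumber H := by
  refine le_iInf₂ fun k hk => ?_
  by_contra hlt
  have hkm : k ≤ m := by
    have := not_le.1 hlt
    exact_mod_cast this.le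
  obtain ⟨c, hc⟩ := hk
  refine h ⟨fun v => Fin.castLE hkm (c v), fun e he => ?_⟩
  rintro ⟨i, hi⟩
  -- A vertex of the edge shows that its common color, a priori only in `Fin m`, comes from `Fin k`.
  obtain ⟨u, hu⟩ := hne e he
  let v : H.vertexSet := ⟨u, H.subset_vertexSet_of_mem_edgeSet' he hu⟩
  exact hc e he ⟨c v, fun w hw => Fin.castLE_injective hkm ((hi w hw).trans (hi v hu).symm)⟩

open Combinatorics in
/-- The combinatorial lines form hypergraphs of arbitrarily large weak chromatic number. -/
theorem exists_not_weaklyColorable (k m : ℕ) : ∃ (ι : Type) (_ : Fintype ι),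
    ¬ WeaklyColorable (hypergraphOf (Set.range (linePoints (α := Fin (k + 1)) (ι := ι)))) m := by
  classical
  -- The extra color `none` is a default for points outside the vertex set; it never occurs on a
  -- line.
  obtain ⟨ι, hι, hmono⟩ := Line.exists_mono_in_high_dimension (Fin (k + 1)) (Option (Fin m))
  refine ⟨ι, hι, ?_⟩
  rintro ⟨c, hc⟩
  obtain ⟨l, i, hi⟩ := hmono fun x => if hx : x ∈ Hypergraph.vertexSet _ then some (c ⟨x, hx⟩)
    else none
  have hmem : ∀ a, l a ∈ (hypergraphOf (Set.range linePoints)).vertexSet := fun a =>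
    ⟨linePoints l, ⟨l, rfl⟩, mem_linePoints.2 ⟨a, rfl⟩⟩
  have hcol : ∀ a, some (c ⟨l a, hmem a⟩) = i := fun a => by
    rw [← hi a]
    simp only [dif_pos (hmem a)]
  refine hc _ ⟨linePoints l, ⟨l, rfl⟩, rfl⟩ ⟨c ⟨l 0, hmem 0⟩, ?_⟩
  rintro ⟨v, hv⟩ hvl
  obtain ⟨a, rfl⟩ := mem_linePoints.1 hvl
  exact Option.some_injective _ ((hcol a).trans (hcol 0).symm)

end FacetHypergraph

end PLChromatic

theorem theoremB (d : ℕ) (hd : 3 ≤ d) : PLChromatic.chiPL (d + 1) d = ⊤ := by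
  classical
  rw [ENat.eq_top_iff_forall_ge]
  intro m
  obtain ⟨ι, hι, hcol⟩ := PLChromatic.exists_not_weaklyColorable d m
  let 𝓕 : Set (Finset (ι → Fin (d + 1))) := Set.range PLChromatic.linePoints
  have hcard : ∀ F ∈ 𝓕, F.card = d + 1 := by
    rintro _ ⟨l, rfl⟩
    rw [PLChromatic.card_linePoints, Fintype.card_fin]
  refine (PLChromatic.le_weakChromaticNumber ?_ hcol).trans (le_sSup
    ⟨ι → Fin (d + 1), PLChromatic.hypergraphOf 𝓕, Set.toFinite _, PLChromatic.isUniform_hypergraphOf hcard,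
      ⟨PLChromatic.complexOf 𝓕, PLChromatic.isFacetHypergraph_hypergraphOf d.succ_pos hcard,
        PLChromatic.plEmbeddable_complexOf hd hcard ?_⟩, rfl⟩)
  · rintro _ ⟨_, ⟨l, rfl⟩, rfl⟩
    exact ⟨l 0, PLChromatic.mem_linePoints.2 ⟨0, rfl⟩⟩
  · rintro _ ⟨l, rfl⟩ _ ⟨l', rfl⟩ h
    exact PLChromatic.card_linePoints_inter_le_one h
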